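/- A real rectangular matrix is called totally non-negative if all of its minors are non-negative (so, in particular, all of its entries are non-negative). Let $F : [0,\infty) \to \mathbb{R}$ be a function, and for a real matrix $A = (a_{ij})$ with non-negative entries let $F[A] := (F(a_{ij}))$ denote the matrix obtained by applying $F$ to each entry. The following are equivalent. 1. For all $m, n$ and every totally non-negative real $m \times n$ matrix $A$, the matrix $F[A]$ is totally non-negative. 2. For all $n$ and every symmetric totally non-negative real $n \times n$ matrix $A$, the matrix $F[A]$ is totally non-negative. 3. There exists a real number $c \geq 0$ such that either $F(x) = c$ for all $x \geq 0$, or $F(x) = c x$ for all $x \geq 0$. -/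

import Mathlib

open scoped NNReal

/-- A real rectangular matrix is totally non-negative if every minor is non-negative.  A minor of
order `k` is the determinant of the submatrix on `k` rows and `k` columns, taken in increasing
order (the empty minor, equal to `1`, is allowed and imposes no condition). -/
def Matrix.IsTotallyNonneg {m n : ℕ} (A : Matrix (Fin m) (Fin n) ℝ) : Prop :=
  ∀ (k : ℕ) (r : Fin k ↪o Fin m) (c : Fin k ↪o Fin n), 0 ≤ (A.submatrix r c).det

/-- The entries of a totally non-negative matrix, being its minors of order one,
are non-negative. -/
theorem Matrix.IsTotallyNonneg.apply_nonneg {m n : ℕ} {A : Matrix (Fin m) (Fin n) ℝ}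
    (hA : A.IsTotallyNonneg) (i : Fin m) (j : Fin n) : 0 ≤ A i j := by
  have h := hA 1 (OrderEmbedding.ofStrictMono (fun _ => i) (Subsingleton.strictMono _))
    (OrderEmbedding.ofStrictMono (fun _ => j) (Subsingleton.strictMono _))
  simpa using h

/-- The matrix `F[A]`: the function `F`, defined on `[0, ∞)`, applied to each entry of a matrix
`A` with non-negative entries. -/
def Matrix.entrywise {m n : ℕ} (F : ℝ≥0 → ℝ) (A : Matrix (Fin m) (Fin n) ℝ)
    (hA : ∀ i j, 0 ≤ A i j) : Matrix (Fin m) (Fin n) ℝ :=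
  Matrix.of fun i j => F ⟨A i j, hA i j⟩

/-! Only 2 → 3 has substance. For `v ≥ 0` the rank one matrix `v vᵀ` is totally non-negative, and
off-diagonal 2×2 minors of its image under `f` force `f (a * b) * f 1 = f a * f b`. Symmetric 2×2
matrices make `f` monotone, so by Cauchy's equation `f` is zero or `c * x ^ a` on `x > 0`, with `a ≥
0`.

A singular tridiagonal 3×3 matrix settles the lower range: `a = 0` forces `f 0 = f 1`, while `a > 0`
forces `a ≥ 1`. For `a ≤ 1`, `onesPerturbation ε` has a 4×4 minor that is identically zero; under `c
* x ^ a` its `ε ^ 4` coefficient is a negative multiple of `a - 1`.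

The test matrices are totally non-negative because they arise from diagonal ones by adding
non-negative multiples of neighbouring rows and columns. -/

open Filter Topology

/-! ### Operations preserving total non-negativity -/

namespace Matrix

variable {m n k : ℕ}

namespace IsTotallyNonneg

/-- A repeated row or column only makes the determinant vanish, so strictness of the index maps can
be dropped. -/
theorem det_submatrix_nonneg {A : Matrix (Fin m) (Fin n) ℝ} (hA : A.IsTotallyNonneg)
    {r : Fin k → Fin m} {c : Fin k → Fin n} (hr : Monotone r) (hc : Monotone c) :
    0 ≤ (A.submatrix r c).det := by
  by_cases hri : Function.Injective r
  · by_cases hci : Function.Injective c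
    · exact hA k (OrderEmbedding.ofStrictMono r (hr.strictMono_of_injective hri))
        (OrderEmbedding.ofStrictMono c (hc.strictMono_of_injective hci))
    · obtain ⟨i, j, hij, hne⟩ := Function.not_injective_iff.1 hci
      exact (det_zero_of_column_eq hne fun p => by simp [hij]).ge
  · obtain ⟨i, j, hij, hne⟩ := Function.not_injective_iff.1 hri
    exact (det_zero_of_row_eq hne (by ext p; simp [hij])).ge

theorem det_nonneg {A : Matrix (Fin n) (Fin n) ℝ} (hA : A.IsTotallyNonneg) : 0 ≤ A.det :=
  hA.det_submatrix_nonneg (r := id) (c := id) monotone_id monotone_id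

theorem submatrix {A : Matrix (Fin m) (Fin n) ℝ} (hA : A.IsTotallyNonneg)
    {p q : ℕ} {r : Fin p → Fin m} {c : Fin q → Fin n} (hr : Monotone r) (hc : Monotone c) :
    (A.submatrix r c).IsTotallyNonneg := fun k r' c' => by
  rw [submatrix_submatrix]
  exact hA.det_submatrix_nonneg (hr.comp r'.monotone) (hc.comp c'.monotone)

theorem transpose {A : Matrix (Fin m) (Fin n) ℝ} (hA : A.IsTotallyNonneg) :
    Aᵀ.IsTotallyNonneg := fun k r c => by
  rw [← det_transpose]
  exact hA k c r

/-- Scaling the rows and the columns by non-negative numbers. -/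
theorem scale {A : Matrix (Fin m) (Fin n) ℝ} (hA : A.IsTotallyNonneg)
    {v : Fin m → ℝ} {w : Fin n → ℝ} (hv : ∀ i, 0 ≤ v i) (hw : ∀ j, 0 ≤ w j) :
    (of fun i j => v i * (w j * A i j)).IsTotallyNonneg := fun k r c => by
  have h : (of fun i j => v i * (w j * A i j)).submatrix r c
      = of fun i j => v (r i) * (of (fun i j => w (c j) * A.submatrix r c i j)) i j := rfl
  rw [h, det_mul_column, det_mul_row]
  exact mul_nonneg (Finset.prod_nonneg fun _ _ => hv _)
    (mul_nonneg (Finset.prod_nonneg fun _ _ => hw _) (hA k r c))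

theorem smul {A : Matrix (Fin m) (Fin n) ℝ} (hA : A.IsTotallyNonneg) {c : ℝ} (hc : 0 ≤ c) :
    (c • A).IsTotallyNonneg := by
  convert hA.scale (v := fun _ => c) (w := fun _ => 1) (fun _ => hc) fun _ => zero_le_one using 1
  ext i j
  simp

/-- Adding a non-negative multiple of a neighbouring row; neighbourhood is expressed by
monotonicity of the map that sends `i` to `j` and fixes every other index. -/
theorem updateRow_add {A : Matrix (Fin m) (Fin n) ℝ} (hA : A.IsTotallyNonneg) (i j : Fin m)
    (hij : Monotone (Function.update id i j)) {w : ℝ} (hw : 0 ≤ w) :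
    (A.updateRow i (A i + w • A j)).IsTotallyNonneg := fun k r c => by
  by_cases hi : i ∈ Set.range r
  · obtain ⟨p, rfl⟩ := hi
    have h1 : (A.updateRow (r p) (A (r p) + w • A j)).submatrix r c
        = (A.submatrix r c).updateRow p
          ((A.submatrix r c) p + w • fun q => A j (c q)) := by
      ext a b
      by_cases hap : a = p
      · subst hap; simp
      · simp [updateRow_ne, hap, r.injective.ne hap]
    have h2 : (A.submatrix r c).updateRow p (fun q => A j (c q))
        = A.submatrix (Function.update id (r p) j ∘ r) c := by
      ext a b
      by_cases hap : a = p
      · subst hap; simp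
      · simp [updateRow_ne, hap]
    -- By linearity in row `p`, the new minor is the old one plus `w` times a minor whose row map is
    -- still monotone.
    rw [h1, det_updateRow_add, det_updateRow_smul, updateRow_eq_self, h2]
    exact add_nonneg (hA k r c)
      (mul_nonneg hw (hA.det_submatrix_nonneg (hij.comp r.monotone) c.monotone))
  · have h1 : (A.updateRow i (A i + w • A j)).submatrix r c = A.submatrix r c := by
      ext a b
      have : r a ≠ i := fun h => hi ⟨a, h⟩
      simp [updateRow_ne, this]
    rw [h1]
    exact hA k r c

/-- Adding a non-negative multiple of a neighbouring row, and then the same for columns. -/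
theorem congr_add {A : Matrix (Fin n) (Fin n) ℝ} (hA : A.IsTotallyNonneg) (i j : Fin n)
    (hij : Monotone (Function.update id i j)) {w : ℝ} (hw : 0 ≤ w) :
    (of fun p q => (A p q + if p = i then w * A j q else 0)
      + if q = i then w * (A p j + if p = i then w * A j j else 0) else 0).IsTotallyNonneg := by
  convert (((hA.updateRow_add i j hij hw).transpose).updateRow_add i j hij hw).transpose using 1
  ext p q
  by_cases hp : p = i <;> by_cases hq : q = i <;> simp [updateRow_apply, hp, hq]

end IsTotallyNonneg

/-! ### Constant, rank one and diagonal matrices -/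

theorem isTotallyNonneg_const {c : ℝ} (hc : 0 ≤ c) :
    (of fun (_ : Fin m) (_ : Fin n) => c).IsTotallyNonneg := fun k r s => by
  match k with
  | 0 => simp
  | 1 => simpa using hc
  | k + 2 => exact (det_zero_of_row_eq (i := 0) (j := 1) (by simp) rfl).ge

theorem isTotallyNonneg_vecMulVec {v : Fin m → ℝ} {w : Fin n → ℝ} (hv : ∀ i, 0 ≤ v i)
    (hw : ∀ j, 0 ≤ w j) : (vecMulVec v w).IsTotallyNonneg := by
  convert (isTotallyNonneg_const zero_le_one).scale hv hw using 1
  ext i j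
  simp [vecMulVec_apply]

theorem isTotallyNonneg_diagonal {d : Fin n → ℝ} (hd : ∀ i, 0 ≤ d i) :
    (diagonal d).IsTotallyNonneg := fun k r c => by
  by_cases h : Set.range r = Set.range c
  · have hrc : r = c := by
      have := (Set.range_injOn_strictMono (β := Fin k) (γ := Fin n)) r.strictMono c.strictMono h
      exact DFunLike.coe_injective this
    subst hrc
    rw [submatrix_diagonal _ _ r.injective, det_diagonal]
    exact Finset.prod_nonneg fun _ _ => hd _
  -- Distinct index sets of equal size: some chosen row meets no chosen column on the diagonal, so
  -- it is zero.
  · have : ∃ p, r p ∉ Set.range c := by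
      by_contra! hsub
      refine h (Set.eq_of_subset_of_ncard_le (Set.range_subset_iff.2 hsub) ?_)
      rw [Set.ncard_range_of_injective r.injective, Set.ncard_range_of_injective c.injective]
    obtain ⟨p, hp⟩ := this
    refine (det_eq_zero_of_row_eq_zero p fun q => ?_).ge
    exact diagonal_apply_ne _ fun hq => hp ⟨q, hq.symm⟩

end Matrix

/-! ### Power functions: Cauchy's equation and second order expansion -/

/-- A monotone additive function on the reals is linear. -/
theorem eq_mul_of_monotone_of_add {h : ℝ → ℝ} (hmono : Monotone h)
    (hadd : ∀ x y, h (x + y) = h x + h y) (t : ℝ) : h t = t * h 1 := by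
  let φ : ℝ →+ ℝ := AddMonoidHom.mk' h hadd
  have hφ : Continuous φ := MeasureTheory.Measure.AddMonoidHom.continuous_of_measurable φ hmono.measurable
  simpa [φ] using map_real_smul φ hφ t 1

/-- A positive, monotone, multiplicative function on the positive reals is a power function. -/
theorem eq_rpow_of_monotoneOn_of_mul {g : ℝ → ℝ} (hpos : ∀ x, 0 < x → 0 < g x)
    (hmono : MonotoneOn g (Set.Ioi 0))
    (hmul : ∀ x y, 0 < x → 0 < y → g (x * y) = g x * g y) :
    ∃ a : ℝ, 0 ≤ a ∧ ∀ x, 0 < x → g x = x ^ a := by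
  have hm : Monotone fun t => Real.log (g (Real.exp t)) := fun s t hst =>
    Real.log_le_log (hpos _ (Real.exp_pos s))
      (hmono (Real.exp_pos s) (Real.exp_pos t) (Real.exp_le_exp.2 hst))
  have hlin := eq_mul_of_monotone_of_add hm fun x y => by
    rw [Real.exp_add, hmul _ _ (Real.exp_pos x) (Real.exp_pos y),
      Real.log_mul (hpos _ (Real.exp_pos x)).ne' (hpos _ (Real.exp_pos y)).ne']
  have h0 := hlin 0
  refine ⟨Real.log (g (Real.exp 1)), ?_, fun x hx => ?_⟩
  · have := hm zero_le_one
    simp only [zero_mul] at h0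
    simpa only [h0] using this
  · have := hlin (Real.log x)
    simp only [Real.exp_log hx] at this
    rw [Real.rpow_def_of_pos hx, ← this, Real.exp_log (hpos x hx)]

/-- The second order Taylor coefficient of `(1 + x) ^ a` at `0`. -/
theorem tendsto_one_add_rpow_second_order (a : ℝ) :
    Tendsto (fun x : ℝ => ((1 + x) ^ a - 1 - a * x) / x ^ 2) (𝓝[>] 0)
      (𝓝 (a * (a - 1) / 2)) := by
  have hd (b x : ℝ) (hx : 0 ≤ x) :
      HasDerivAt (fun x : ℝ => (1 + x) ^ b) (b * (1 + x) ^ (b - 1)) x := by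
    have := ((hasDerivAt_id x).const_add 1).rpow_const (p := b)
      (Or.inl (by simp only [id]; positivity))
    simpa using this
  have hc (f : ℝ → ℝ) (hf : ContinuousAt f 0) (h0 : f 0 = 0) : Tendsto f (𝓝[>] 0) (𝓝 0) := by
    simpa [h0] using hf.tendsto.mono_left nhdsWithin_le_nhds
  refine HasDerivAt.lhopital_zero_nhdsGT (f' := fun x => a * (1 + x) ^ (a - 1) - a)
    (g' := fun x => 2 * x) ?_ ?_ ?_ ?_ ?_ ?_
  · filter_upwards [self_mem_nhdsWithin] with x hx
    have := ((hd a x hx.le).sub_const 1).sub ((hasDerivAt_id x).const_mul a)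
    rw [mul_one] at this
    exact this
  · exact .of_forall fun x => by simpa using hasDerivAt_pow 2 x
  · filter_upwards [self_mem_nhdsWithin] with x hx
    exact mul_ne_zero two_ne_zero (ne_of_gt hx)
  · refine hc _ ?_ (by simp)
    have h1 := (hd a 0 le_rfl).continuousAt
    fun_prop
  · exact hc _ (by fun_prop) (by simp)
  -- The quotient of derivatives is `a / 2` times the difference quotient of `(1 + x) ^ (a - 1)` at
  -- `0`.
  · have h := (hd (a - 1) 0 le_rfl).tendsto_slope_zero_right.const_mul (a / 2)
    have e : a / 2 * ((a - 1) * (1 + 0) ^ (a - 1 - 1)) = a * (a - 1) / 2 := by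
      rw [add_zero, Real.one_rpow]; ring
    rw [e] at h
    refine h.congr' ?_
    filter_upwards [self_mem_nhdsWithin] with x hx
    have hx' : x ≠ 0 := ne_of_gt hx
    simp only [zero_add, add_zero, Real.one_rpow, smul_eq_mul]
    field_simp

/-- The normalised second order remainder of `(1 + m * ε) ^ a`. -/
theorem tendsto_one_add_mul_rpow_second_order {a : ℝ} (ha : a ≠ 0) {m : ℝ} (hm : 0 ≤ m) :
    Tendsto (fun ε : ℝ => ((1 + m * ε) ^ a - 1 - a * (m * ε)) / (a * ε ^ 2)) (𝓝[>] 0)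
      (𝓝 ((a - 1) / 2 * m ^ 2)) := by
  rcases hm.eq_or_lt with rfl | hm
  · simp
  have hlim : Tendsto (fun ε : ℝ => m * ε) (𝓝[>] 0) (𝓝[>] 0) := by
    refine tendsto_nhdsWithin_iff.2 ⟨?_, ?_⟩
    · have : Continuous fun ε : ℝ => m * ε := by fun_prop
      simpa using (this.tendsto 0).mono_left nhdsWithin_le_nhds
    · filter_upwards [self_mem_nhdsWithin] with ε hε using mul_pos hm hε
  have h := ((tendsto_one_add_rpow_second_order a).comp hlim).const_mul (m ^ 2 / a)
  have e : m ^ 2 / a * (a * (a - 1) / 2) = (a - 1) / 2 * m ^ 2 := by field_simp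
  rw [e] at h
  refine h.congr' ?_
  filter_upwards [self_mem_nhdsWithin] with ε hε
  have hε' : ε ≠ 0 := ne_of_gt hε
  simp only [Function.comp]
  field_simp

/-! ### Test matrices -/

namespace Matrix

theorem isTotallyNonneg_fin_two {a b : ℝ} (hb : 0 ≤ b) (hba : b ≤ a) :
    (!![a, b; b, a] : Matrix (Fin 2) (Fin 2) ℝ).IsTotallyNonneg := by
  rcases (hb.trans hba).eq_or_lt with rfl | ha
  · obtain rfl := hba.antisymm hb
    convert isTotallyNonneg_const (m := 2) (n := 2) (le_refl (0 : ℝ)) using 1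
    ext i j; fin_cases i <;> fin_cases j <;> rfl
  · have hd : ∀ i, 0 ≤ (![a, a - b ^ 2 / a] : Fin 2 → ℝ) i := by
      intro i
      fin_cases i
      · exact ha.le
      · have : b ^ 2 / a ≤ a := by rw [div_le_iff₀ ha]; nlinarith
        simpa using this
    convert (isTotallyNonneg_diagonal hd).congr_add 1 0 (by decide) (w := b / a) (by positivity)
      using 1
    ext i j
    fin_cases i <;> fin_cases j <;> simp <;> field_simp <;> ring

theorem isTotallyNonneg_tridiagonal :
    (!![2, 2, 0; 2, 4, 2; 0, 2, 2] : Matrix (Fin 3) (Fin 3) ℝ).IsTotallyNonneg := by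
  have hd : ∀ i, 0 ≤ (![2, 2, 0] : Fin 3 → ℝ) i := by
    intro i; fin_cases i <;> simp
  convert ((isTotallyNonneg_diagonal hd).congr_add 2 1 (by decide) zero_le_one).congr_add 1 0
    (by decide) zero_le_one using 1
  ext i j
  fin_cases i <;> fin_cases j <;> simp <;> norm_num

/-- A symmetric perturbation of the all-ones matrix, one of whose minors of order four vanishes
to fourth order in `ε`. -/
def onesPerturbation (ε : ℝ) : Matrix (Fin 5) (Fin 5) ℝ :=
  !![1, 1, 1, 1, 1;
     1, 1 + 2 * ε, 1 + 3 * ε, 1 + 4 * ε, 1 + 4 * ε;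
     1, 1 + 3 * ε, 1 + 5 * ε, 1 + 7 * ε, 1 + 8 * ε;
     1, 1 + 4 * ε, 1 + 7 * ε, 1 + 10 * ε, 1 + 12 * ε;
     1, 1 + 4 * ε, 1 + 8 * ε, 1 + 12 * ε, 1 + 16 * ε]

theorem onesPerturbation_isSymm (ε : ℝ) : (onesPerturbation ε).IsSymm :=
  IsSymm.ext fun i j => by fin_cases i <;> fin_cases j <;> rfl

theorem onesPerturbation_isTotallyNonneg {ε : ℝ} (hε : 0 ≤ ε) :
    (onesPerturbation ε).IsTotallyNonneg := by
  have hd : ∀ i, 0 ≤ (![1, 2 * ε, 0, 2 * ε] : Fin 4 → ℝ) i := by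
    intro i; fin_cases i <;> simp [hε]
  have h1 : (!![1, 0, 0, 0; 0, 2 * ε, ε, 0; 0, ε, ε, ε; 0, 0, ε, 2 * ε] :
      Matrix (Fin 4) (Fin 4) ℝ).IsTotallyNonneg := by
    convert ((isTotallyNonneg_diagonal hd).congr_add 2 1 (by decide)
      (one_half_pos (α := ℝ)).le).congr_add 2 3 (by decide) (one_half_pos (α := ℝ)).le using 1
    ext i j
    fin_cases i <;> fin_cases j <;> simp <;> ring
  -- Row and column 2 are duplicated; the additions that follow take partial sums of rows and
  -- columns.
  have h2 : (!![1, 0, 0, 0, 0; 0, 2 * ε, ε, ε, 0; 0, ε, ε, ε, ε; 0, ε, ε, ε, ε; 0, 0, ε, ε, 2 * ε] :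
      Matrix (Fin 5) (Fin 5) ℝ).IsTotallyNonneg := by
    convert h1.submatrix (r := ![0, 1, 2, 2, 3]) (c := ![0, 1, 2, 2, 3]) (by decide) (by decide)
      using 1
    ext i j
    fin_cases i <;> fin_cases j <;> rfl
  have h3 : (!![1, 1, 1, 0, 0; 1, 1 + 2 * ε, 1 + 3 * ε, ε, 0; 1, 1 + 3 * ε, 1 + 5 * ε, 2 * ε, ε;
      0, ε, 2 * ε, ε, ε; 0, 0, ε, ε, 2 * ε] : Matrix (Fin 5) (Fin 5) ℝ).IsTotallyNonneg := by
    convert (h2.congr_add 1 0 (by decide) zero_le_one).congr_add 2 1 (by decide) zero_le_one using 1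
    ext i j
    fin_cases i <;> fin_cases j <;> simp <;> ring
  convert (h3.congr_add 3 2 (by decide) zero_le_one).congr_add 4 3 (by decide) zero_le_one using 1
  ext i j
  fin_cases i <;> fin_cases j <;> simp [onesPerturbation] <;> ring

end Matrix

/-! ### Constraints on a preserver -/

/-- The map `f`, applied entrywise, sends symmetric totally non-negative matrices to totally
non-negative matrices. -/
def PreservesSymmTotallyNonneg (f : ℝ → ℝ) : Prop :=
  ∀ (n : ℕ) (A : Matrix (Fin n) (Fin n) ℝ), A.IsSymm → A.IsTotallyNonneg →
    (A.map f).IsTotallyNonneg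

namespace PreservesSymmTotallyNonneg

open Matrix

variable {f : ℝ → ℝ}

theorem nonneg (hf : PreservesSymmTotallyNonneg f) {x : ℝ} (hx : 0 ≤ x) : 0 ≤ f x :=
  (hf 1 (of fun _ _ => x) (IsSymm.ext fun _ _ => rfl)
    (isTotallyNonneg_const hx)).apply_nonneg 0 0

theorem monotoneOn (hf : PreservesSymmTotallyNonneg f) : MonotoneOn f (Set.Ici 0) := by
  intro b hb a ha hba
  have h := (hf 2 !![a, b; b, a] (IsSymm.ext fun i j => by fin_cases i <;> fin_cases j <;> rfl)
    (isTotallyNonneg_fin_two hb hba)).det_nonneg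
  simp only [det_fin_two, map_apply, of_apply, cons_val', cons_val_zero, cons_val_one,
    cons_val_fin_one] at h
  exact abs_le_of_sq_le_sq' (by nlinarith) (hf.nonneg ha) |>.2

/-- The minor of `v vᵀ` on rows 0, 1 and columns 2, 3 avoids the diagonal, so the matrix can be
symmetric while all four factors stay free. Swapping `v 2` and `v 3` reverses the inequality. -/
theorem mul_le_mul (hf : PreservesSymmTotallyNonneg f) {v : Fin 4 → ℝ} (hv : ∀ i, 0 ≤ v i) :
    f (v 0 * v 3) * f (v 1 * v 2) ≤ f (v 0 * v 2) * f (v 1 * v 3) := by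
  have h := (hf 4 (vecMulVec v v) (IsSymm.ext fun i j => by simp [vecMulVec_apply, mul_comm])
    (isTotallyNonneg_vecMulVec hv hv)).det_submatrix_nonneg (r := ![0, 1]) (c := ![2, 3])
    (by decide) (by decide)
  simp only [det_fin_two, submatrix_apply, map_apply, vecMulVec_apply, cons_val_zero,
    cons_val_one] at h
  linarith

theorem map_mul (hf : PreservesSymmTotallyNonneg f) {a b : ℝ} (ha : 0 ≤ a) (hb : 0 ≤ b) :
    f (a * b) * f 1 = f a * f b := by
  apply le_antisymm
  · have h := hf.mul_le_mul (v := ![a, 1, 1, b])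
      (by intro i; fin_cases i <;> simp [ha, hb])
    simpa using h
  · have h := hf.mul_le_mul (v := ![a, 1, b, 1])
      (by intro i; fin_cases i <;> simp [ha, hb])
    simpa using h

theorem tridiagonal (hf : PreservesSymmTotallyNonneg f) :
    0 ≤ f 2 * (f 4 * f 2 - f 2 * f 2) - f 2 * (f 2 * f 2 - f 2 * f 0)
      + f 0 * (f 2 * f 2 - f 4 * f 0) := by
  have h := (hf 3 !![2, 2, 0; 2, 4, 2; 0, 2, 2]
    (IsSymm.ext fun i j => by fin_cases i <;> fin_cases j <;> rfl)
    isTotallyNonneg_tridiagonal).det_nonneg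
  rw [det_fin_three] at h
  simp only [map_apply, of_apply, cons_val', cons_val_zero, cons_val_one, cons_val,
    cons_val_fin_one] at h
  linarith

/-- No power with exponent greater than one preserves total non-negativity. -/
theorem exponent_le_one (hf : PreservesSymmTotallyNonneg f) {c a : ℝ} (hc : 0 < c)
    (hfa : ∀ x, 0 < x → f x = c * x ^ a) : a ≤ 1 := by
  by_contra! ha
  have ha0 : 0 < a := by linarith
  -- Chosen so that `f (1 + m * ε) = c * (1 + a * ε * (m + ε * w m ε))`.
  let w (m : ℕ) (ε : ℝ) : ℝ := ((1 + m * ε) ^ a - 1 - a * (m * ε)) / (a * ε ^ 2)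
  -- Clearing the column of ones leaves first order rows (3,4,4), (5,7,8), (7,10,12), whose second
  -- difference is zero. Putting the second difference in place of the first row extracts one more
  -- `ε`; `Q` is the remaining determinant.
  let Q (ε : ℝ) (u : ℕ → ℝ) : ℝ :=
    (u 3 - 2 * u 5 + u 7) * ((7 + ε * u 7) * (12 + ε * u 12) - (8 + ε * u 8) * (10 + ε * u 10))
    - (u 4 - 2 * u 7 + u 10) * ((5 + ε * u 5) * (12 + ε * u 12) - (8 + ε * u 8) * (7 + ε * u 7))
    + (u 4 - 2 * u 8 + u 12) * ((5 + ε * u 5) * (10 + ε * u 10) - (7 + ε * u 7) * (7 + ε * u 7))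
  have hf1 : f 1 = c := by simpa using hfa 1 one_pos
  have hpos : ∀ ε > 0, 0 ≤ Q ε fun m => w m ε := by
    intro ε hε
    have hval (m : ℕ) : f (1 + m * ε) = c * (1 + a * ε * (m + ε * w m ε)) := by
      rw [hfa _ (by positivity)]
      simp only [w]
      field_simp
      ring
    have h := (hf 5 _ (onesPerturbation_isSymm ε)
      (onesPerturbation_isTotallyNonneg hε.le)).det_submatrix_nonneg
      (r := ![0, 1, 2, 3]) (c := ![0, 2, 3, 4]) (by decide) (by decide)
    have e : ((onesPerturbation ε).map f).submatrix ![0, 1, 2, 3] ![0, 2, 3, 4]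
        = !![f 1, f 1, f 1, f 1;
             f 1, f (1 + 3 * ε), f (1 + 4 * ε), f (1 + 4 * ε);
             f 1, f (1 + 5 * ε), f (1 + 7 * ε), f (1 + 8 * ε);
             f 1, f (1 + 7 * ε), f (1 + 10 * ε), f (1 + 12 * ε)] := by
      ext i j
      fin_cases i <;> fin_cases j <;> rfl
    have h3 := hval 3
    have h4 := hval 4
    have h5 := hval 5
    have h7 := hval 7
    have h8 := hval 8
    have h10 := hval 10
    have h12 := hval 12
    push_cast at h3 h4 h5 h7 h8 h10 h12
    rw [e, hf1, h3, h4, h5, h7, h8, h10, h12, det_succ_row_zero] at h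
    simp only [Fin.sum_univ_succ, det_fin_three, Fin.succAbove, submatrix_apply] at h
    simp at h
    have h' : 0 ≤ (c ^ 4 * a ^ 3 * ε ^ 4) * Q ε fun m => w m ε := by
      refine h.trans_eq ?_
      simp only [Q]
      ring
    exact nonneg_of_mul_nonneg_right h' (by positivity)
  have hQ : Continuous fun p : ℝ × (ℕ → ℝ) => Q p.1 p.2 := by
    simp only [Q]
    fun_prop
  have hlim : Tendsto (fun ε => (ε, fun m => w m ε)) (𝓝[>] (0 : ℝ))
      (𝓝 (0, fun m : ℕ => (a - 1) / 2 * (m : ℝ) ^ 2)) :=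
    (tendsto_nhdsWithin_of_tendsto_nhds tendsto_id).prodMk_nhds (tendsto_pi_nhds.2 fun m =>
      tendsto_one_add_mul_rpow_second_order ha0.ne' m.cast_nonneg)
  have h := ge_of_tendsto ((hQ.tendsto _).comp hlim)
    (eventually_mem_nhdsWithin.mono fun ε hε => hpos ε hε)
  -- At the limit point `Q` equals `-4 * (a - 1)`.
  simp only [Q] at h
  push_cast at h
  linarith

theorem eq_const_or_eq_mul (hf : PreservesSymmTotallyNonneg f) :
    ∃ c : ℝ, 0 ≤ c ∧ ((∀ x, 0 ≤ x → f x = c) ∨ ∀ x, 0 ≤ x → f x = c * x) := by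
  have h0 := hf.nonneg le_rfl
  rcases (hf.nonneg zero_le_one).eq_or_lt with h1 | h1
  · refine ⟨0, le_rfl, Or.inl fun x hx => ?_⟩
    have := hf.map_mul hx hx
    rw [← h1, mul_zero] at this
    exact mul_self_eq_zero.1 this.symm
  have hpos (x : ℝ) (hx : 0 < x) : 0 < f x := by
    have := hf.map_mul hx.le (inv_nonneg.2 hx.le)
    rw [mul_inv_cancel₀ hx.ne'] at this
    refine (hf.nonneg hx.le).lt_of_ne fun h => ?_
    rw [← h, zero_mul] at this
    exact (mul_pos h1 h1).ne' this
  obtain ⟨a, ha, hpow⟩ := eq_rpow_of_monotoneOn_of_mul (g := fun x => f x / f 1)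
    (fun x hx => div_pos (hpos x hx) h1)
    (fun x hx y hy hxy => by
      have := hf.monotoneOn (Set.mem_Ici.2 (le_of_lt hx)) (Set.mem_Ici.2 (le_of_lt hy)) hxy
      dsimp only
      gcongr)
    (fun x y hx hy => by
      have := hf.map_mul hx.le hy.le
      field_simp
      linarith)
  have hfa (x : ℝ) (hx : 0 < x) : f x = f 1 * x ^ a := by
    rw [← hpow x hx]
    field_simp
  have htri := hf.tridiagonal
  refine ⟨f 1, h1.le, ?_⟩
  rcases ha.eq_or_lt with rfl | ha
  · left
    have hconst (x : ℝ) (hx : 0 < x) : f x = f 1 := by simpa using hfa x hx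
    rw [hconst 2 two_pos, hconst 4 four_pos] at htri
    have : f 0 = f 1 := by
      -- With `f 2 = f 4 = f 1`, the tridiagonal determinant is `-f 1 * (f 1 - f 0) ^ 2`.
      have h : f 1 * (f 1 - f 0) ^ 2 ≤ 0 := by linarith
      have h2 : (f 1 - f 0) ^ 2 ≤ 0 := nonpos_of_mul_nonpos_right h h1
      nlinarith [pow_eq_zero_iff (two_ne_zero) |>.1 (h2.antisymm (sq_nonneg _))]
    intro x hx
    rcases hx.eq_or_lt with rfl | hx
    · exact this
    · exact hconst x hx
  · right
    have hzero : f 0 = 0 := by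
      refine le_antisymm ?_ h0
      have hlim : Tendsto (fun x : ℝ => f 1 * x ^ a) (𝓝[>] 0) (𝓝 0) := by
        have := ((Real.continuousAt_rpow_const 0 a (Or.inr ha.le)).tendsto.const_mul
          (f 1)).mono_left (nhdsWithin_le_nhds (s := Set.Ioi 0))
        simpa [Real.zero_rpow ha.ne'] using this
      refine ge_of_tendsto hlim ?_
      filter_upwards [self_mem_nhdsWithin] with x hx
      rw [← hfa x hx]
      exact hf.monotoneOn Set.self_mem_Ici (Set.mem_Ici.2 (le_of_lt hx)) (le_of_lt hx)
    have h4 : f 4 * f 1 = f 2 * f 2 := by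
      have := hf.map_mul (a := 2) (b := 2) zero_le_two zero_le_two
      norm_num at this
      exact this
    have h2 := hpos 2 two_pos
    have hge : 2 * f 1 ≤ f 2 := by
      rw [hzero] at htri
      -- With `f 0 = 0` the tridiagonal determinant is `f 2 ^ 2 * (f 4 - 2 * f 2)`; multiplying by
      -- `f 1` eliminates `f 4`.
      have h : 0 ≤ f 2 ^ 3 * (f 2 - 2 * f 1) := by
        have := mul_nonneg htri h1.le
        linear_combination this + f 2 ^ 2 * h4
      have := nonneg_of_mul_nonneg_right h (by positivity)
      linarith
    have ha1 : 1 ≤ a := by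
      rw [hfa 2 two_pos] at hge
      have : (2 : ℝ) ^ (1 : ℝ) ≤ 2 ^ a := by
        rw [Real.rpow_one]
        exact le_of_mul_le_mul_left (by linarith) h1
      exact (Real.rpow_le_rpow_left_iff one_lt_two).1 this
    obtain rfl := (hf.exponent_le_one h1 hfa).antisymm ha1
    intro x hx
    rcases hx.eq_or_lt with rfl | hx
    · simpa using hzero
    · simpa using hfa x hx

end PreservesSymmTotallyNonneg

/-! ### From functions on `ℝ≥0` to functions on `ℝ`, and the equivalence -/

namespace Matrix

theorem entrywise_eq_map {m n : ℕ} (F : ℝ≥0 → ℝ) (A : Matrix (Fin m) (Fin n) ℝ)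
    (hA : ∀ i j, 0 ≤ A i j) : entrywise F A hA = A.map fun x => F x.toNNReal := by
  ext i j
  simp only [entrywise, of_apply, map_apply, Real.toNNReal_of_nonneg (hA i j)]
  rfl

end Matrix

theorem theorem4 (F : ℝ≥0 → ℝ) :
    [ -- `F` preserves total non-negativity of all rectangular matrices
      ∀ (m n : ℕ) (A : Matrix (Fin m) (Fin n) ℝ) (hA : A.IsTotallyNonneg),
        (Matrix.entrywise F A hA.apply_nonneg).IsTotallyNonneg,
      -- `F` preserves total non-negativity of all symmetric matrices
      ∀ (n : ℕ) (A : Matrix (Fin n) (Fin n) ℝ) (_ : A.IsSymm) (hA : A.IsTotallyNonneg),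
        (Matrix.entrywise F A hA.apply_nonneg).IsTotallyNonneg,
      -- `F` is a non-negative constant or a non-negative multiple of the identity
      ∃ c : ℝ, 0 ≤ c ∧ ((∀ x : ℝ≥0, F x = c) ∨ (∀ x : ℝ≥0, F x = c * (x : ℝ)))
    ].TFAE := by
  tfae_have 1 → 2 := fun h n A _ hA => h n n A hA
  tfae_have 2 → 3 := fun h => by
    have hf : PreservesSymmTotallyNonneg fun x => F x.toNNReal := fun n A hs hA => by
      rw [← Matrix.entrywise_eq_map F A hA.apply_nonneg]
      exact h n A hs hA
    obtain ⟨c, hc, h⟩ := hf.eq_const_or_eq_mul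
    refine ⟨c, hc, h.imp (fun h x => ?_) fun h x => ?_⟩ <;> simpa using h x x.2
  tfae_have 3 → 1 := by
    rintro ⟨c, hc, h | h⟩ m n A hA
    · convert Matrix.isTotallyNonneg_const (m := m) (n := n) hc using 1
      ext i j
      exact h _
    · convert hA.smul hc using 1
      ext i j
      exact h _
  tfae_finish
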